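/- Let $F_0=0$, $F_1=1$, $F_{t+2}=F_{t+1}+F_t$ be the Fibonacci numbers, let $\gamma=(3-\sqrt5)/2$, and let $\mathbf f=f_0f_1f_2\cdots=01001010\cdots$ be the Fibonacci word, that is, $f_j=\lfloor (j+2)\gamma\rfloor-\lfloor (j+1)\gamma\rfloor$ for $j\ge 0$. For integers $i,m,n\ge 0$ let $$T(i,m,n)=\sum_{k=0}^{m-1}\sum_{\ell=0}^{n-1} f_{i+k+\ell}$$ be the sum of the entries of the $m\times n$ matrix $(f_{i+k+\ell})_{0\le k<m,\,0\le \ell<n}$. Then: (a) for every integer $k\ge 0$, the number of distinct values of $T(i,F_{3k}/2,F_{3k}/2)$, taken over all $i\ge 0$, is at least $k+1$; (b) for every integer $n\ge 1$, $$T\Bigl(\tfrac{F_{6n-1}-1}{4},\tfrac{F_{6n}}2,\tfrac{F_{6n}}2\Bigr)-T\Bigl(\tfrac{F_{6n+2}-1}{4},\tfrac{F_{6n}}2,\tfrac{F_{6n}}2\Bigr)=2n;$$ (c) for every integer $n\ge 0$, $$T\Bigl(\tfrac{F_{6n+5}-1}{4},\tfrac{F_{6n+3}}2,\tfrac{F_{6n+3}}2\Bigr)-T\Bigl(\tfrac{F_{6n+2}-1}{4},\tfrac{F_{6n+3}}2,\tfrac{F_{6n+3}}2\Bigr)=2n+1.$$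 (All the fractions occurring as arguments of $T$ are integers.) -/

import Mathlib

/-- The slope `γ = (3 - √5) / 2` of the Fibonacci word. -/
noncomputable def fibSlope : ℝ := (3 - Real.sqrt 5) / 2

/-- The infinite Fibonacci word `f₀ f₁ f₂ ⋯ = 01001010⋯`, given by
`f_{n-1} = ⌊(n+1)γ⌋ - ⌊nγ⌋` for `n ≥ 1`; here `j = n - 1`. -/
noncomputable def fibWord (j : ℕ) : ℤ :=
  ⌊((j : ℝ) + 2) * fibSlope⌋ - ⌊((j : ℝ) + 1) * fibSlope⌋

/-- The `m × n` matrix `A(i,m,n)` whose successive rows are shifted length-`n` windows of the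
sequence `a`: its entry in row `k`, column `l` (counted from `0`) is `a (i + k + l)`. -/
def wordRectangle (a : ℕ → ℤ) (i m n : ℕ) : Matrix (Fin m) (Fin n) ℤ :=
  Matrix.of fun k l => a (i + k + l)

/-- The sum `T(i,m,n)` of all entries of `A(i,m,n)`. -/
def rectangleSum (a : ℕ → ℤ) (i m n : ℕ) : ℤ :=
  ∑ k : Fin m, ∑ l : Fin n, wordRectangle a i m n k l

open Finset

/-! Let S be `fibFloorSum` and q_s = `fibQuarter s`. Summing twice makes T(i,m,m) the second
difference S(i+2m) - 2S(i+m) + S(i). If 2m = F(3s+3), then q_(s+1) = q_s + m, so the difference of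
the T-values at q_s and q_(s+1) is a third difference of S. Because Fγ is very close to an integer
for Fibonacci F, S(F+M) splits into S(F), a linear term and S(M) (`fibFloorSum_fib_add`). As q_(s+2)
= F(3s+5) + q_s, the third difference satisfies a recursion in s: its sign alternates and its size
grows by 1. Part (a) follows since T changes by at most 1 when i does, hence takes every
intermediate value. -/

/-- The integers `⌊γ⌋, ⌊2γ⌋, ⌊3γ⌋, …` count the ones in the prefixes of the Fibonacci word;
this is the sum of the first `N` of them. -/
noncomputable def fibFloorSum (N : ℕ) : ℤ :=
  ∑ r ∈ range N, ⌊((r : ℝ) + 1) * fibSlope⌋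

theorem fibFloorSum_zero : fibFloorSum 0 = 0 := by simp [fibFloorSum]

theorem fibFloorSum_succ (N : ℕ) :
    fibFloorSum (N + 1) = fibFloorSum N + ⌊((N : ℝ) + 1) * fibSlope⌋ :=
  sum_range_succ _ _

theorem fibSlope_eq_goldenConj_sq : fibSlope = Real.goldenConj ^ 2 := by
  have h : Real.sqrt 5 ^ 2 = 5 := Real.sq_sqrt (by norm_num)
  rw [fibSlope, Real.goldenConj]
  linear_combination (-1 / 4) * h

theorem fib_mul_fibSlope (j : ℕ) :
    (Nat.fib (j + 2) : ℝ) * fibSlope = Nat.fib j + Real.goldenConj ^ (j + 2) := by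
  rw [fibSlope_eq_goldenConj_sq]
  induction j using Nat.twoStepInduction with
  | zero => simp
  | one =>
    have h := Real.goldenConj_sq
    simp only [Nat.reduceAdd, Nat.fib_one, Nat.fib_add_two (n := 1), Nat.fib_two]
    push_cast
    linear_combination (1 - Real.goldenConj) * h
  | more j h₀ h₁ =>
    have h := Real.goldenConj_sq
    have e2 : (Nat.fib (j + 2) : ℝ) = Nat.fib j + Nat.fib (j + 1) := by
      exact_mod_cast Nat.fib_add_two
    have e4 : (Nat.fib (j + 2 + 2) : ℝ) = Nat.fib (j + 2) + Nat.fib (j + 1 + 2) := by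
      exact_mod_cast Nat.fib_add_two
    rw [e4]
    linear_combination h₀ + h₁ - Real.goldenConj ^ (j + 2) * h - e2

/-- Cassini's identity. -/
theorem fib_cassini (j : ℕ) :
    (Nat.fib (j + 1) : ℤ) ^ 2 - Nat.fib j * Nat.fib (j + 1) - (Nat.fib j : ℤ) ^ 2 = (-1) ^ j := by
  induction j with
  | zero => simp
  | succ j ih =>
    rw [Nat.fib_add_two, pow_succ]
    push_cast
    linear_combination -ih

/-- No integer `p` lies between `nγ` and `nγ + ψ ^ (j + 2)` when `0 < n < F (j + 3)`. -/
theorem no_int_between (j : ℕ) (n p : ℤ) (hn : 0 < n) (hn' : n < Nat.fib (j + 3)) (t : ℝ)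
    (ht : 0 ≤ t) (ht' : t ≤ 1) :
    (n : ℝ) * fibSlope + t * Real.goldenConj ^ (j + 2) ≠ p := by
  intro hp
  have hc := fib_cassini j
  have he : ((-1 : ℤ) ^ j) * (-1) ^ j = 1 := by rw [← mul_pow]; simp
  have h3 : Nat.fib (j + 3) = Nat.fib j + 2 * Nat.fib (j + 1) := by
    rw [Nat.fib_add_two (n := j + 1), Nat.fib_add_two]; ring
  have h2 : Nat.fib (j + 2) = Nat.fib j + Nat.fib (j + 1) := Nat.fib_add_two
  -- By Cassini, (F(j+2), F(j)) and (F(j+3), F(j+1)) form a basis of ℤ²; the witnesses are Cramer's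
  -- rule.
  obtain ⟨u, w, hu, hw⟩ : ∃ u w : ℤ, n = u * Nat.fib (j + 2) + w * Nat.fib (j + 3) ∧
      p = u * Nat.fib j + w * Nat.fib (j + 1) := by
    refine ⟨(-1) ^ j * (Nat.fib (j + 1) * n - Nat.fib (j + 3) * p),
      (-1) ^ j * (Nat.fib (j + 2) * p - Nat.fib j * n), ?_, ?_⟩
    · rw [h2, h3]; push_cast
      linear_combination (-n) * he - n * (-1) ^ j * hc
    · rw [h2, h3]; push_cast
      linear_combination (-p) * he - p * (-1) ^ j * hc
  have hψ := Real.goldenConj_neg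
  have hψ' := Real.neg_one_lt_goldenConj
  have hψ0 : Real.goldenConj ^ (j + 2) ≠ 0 := pow_ne_zero _ hψ.ne
  have key : (u : ℝ) + w * Real.goldenConj = -t := by
    have h₀ := fib_mul_fibSlope j
    have h₁ := fib_mul_fibSlope (j + 1)
    rw [show j + 1 + 2 = j + 3 by ring] at h₁
    rw [hu, hw] at hp
    push_cast at hp
    apply mul_right_cancel₀ hψ0
    linear_combination hp - u * h₀ - w * h₁
  have hF2 : (0 : ℤ) ≤ Nat.fib (j + 2) := Int.natCast_nonneg _
  have hF3 : (0 : ℤ) ≤ Nat.fib (j + 3) := Int.natCast_nonneg _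
  -- As -1 < ψ < 0, `key` forces u ≤ 0 when w ≤ 0, so n ≤ 0, and u ≥ 0 when w ≥ 1, so n ≥ F(j+3).
  rcases le_or_gt w 0 with h | h
  · have hwR : (w : ℝ) ≤ 0 := by exact_mod_cast h
    have : (u : ℝ) ≤ 0 := by nlinarith
    have hu0 : u ≤ 0 := by exact_mod_cast this
    nlinarith
  · have hwR : (1 : ℝ) ≤ w := by exact_mod_cast h
    have : (-1 : ℝ) < u := by nlinarith
    have hu0 : -1 < u := by exact_mod_cast this
    have hu1 : 0 ≤ u := by omega
    nlinarith

theorem floor_fib_add (j r : ℕ) (hr : r + 1 < Nat.fib (j + 3)) :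
    ⌊(((Nat.fib (j + 2) + r : ℕ) : ℝ) + 1) * fibSlope⌋
      = Nat.fib j + ⌊((r : ℝ) + 1) * fibSlope⌋ := by
  set x : ℝ := ((r : ℝ) + 1) * fibSlope with hx
  set δ : ℝ := Real.goldenConj ^ (j + 2) with hδ
  have hne : ∀ (p : ℤ) (t : ℝ), 0 ≤ t → t ≤ 1 → x + t * δ ≠ p := by
    intro p t h0 h1
    have := no_int_between j (r + 1) p (by omega) (by exact_mod_cast hr) t h0 h1
    simpa [hx] using this
  have hfl : ⌊x + δ⌋ = ⌊x⌋ := by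
    rw [Int.floor_eq_iff]
    have hlo := Int.floor_le x
    have hhi := Int.lt_floor_add_one x
    constructor
    · by_contra! hlt
      have hδ0 : δ < 0 := by linarith
      -- t is the fraction of the way from x to x + δ at which the integer is met.
      refine hne ⌊x⌋ ((⌊x⌋ - x) / δ) (div_nonneg_of_nonpos (by linarith) hδ0.le) ?_ ?_
      · rw [div_le_one_of_neg hδ0]; linarith
      · rw [div_mul_cancel₀ _ hδ0.ne]; ring
    · by_contra! hlt
      have hδ0 : 0 < δ := by linarith
      refine hne (⌊x⌋ + 1) ((⌊x⌋ + 1 - x) / δ) (div_nonneg (by linarith) hδ0.le) ?_ ?_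
      · rw [div_le_one hδ0]; linarith
      · rw [div_mul_cancel₀ _ hδ0.ne']; push_cast; ring
  have hexp : (((Nat.fib (j + 2) + r : ℕ) : ℝ) + 1) * fibSlope = (Nat.fib j : ℤ) + (x + δ) := by
    have := fib_mul_fibSlope j
    push_cast
    linear_combination this
  rw [hexp, Int.floor_intCast_add, hfl]

theorem fibFloorSum_fib_add (j M : ℕ) (hM : M < Nat.fib (j + 3)) :
    fibFloorSum (Nat.fib (j + 2) + M)
      = fibFloorSum (Nat.fib (j + 2)) + M * Nat.fib j + fibFloorSum M := by
  induction M with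
  | zero => simp [fibFloorSum_zero]
  | succ M ih =>
    rw [← add_assoc, fibFloorSum_succ, fibFloorSum_succ, ih (by omega), floor_fib_add j M hM]
    push_cast
    ring

theorem floor_fibSlope : ⌊fibSlope⌋ = 0 ∧ ⌊2 * fibSlope⌋ = 0 := by
  have h1 : (2 : ℝ) < Real.sqrt 5 := Real.lt_sqrt_of_sq_lt (by norm_num)
  have h2 : Real.sqrt 5 < 3 := (Real.sqrt_lt' (by norm_num)).2 (by norm_num)
  constructor <;> rw [Int.floor_eq_iff, fibSlope] <;> constructor <;> push_cast <;> linarith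

/-- Splitting at F(j+4) = F(j+3) + F(j+2) gives a recurrence; Cassini absorbs the quadratic terms.
-/
theorem two_mul_fibFloorSum_fib (j : ℕ) :
    2 * fibFloorSum (Nat.fib (j + 2))
      = Nat.fib (j + 2) * Nat.fib j - Nat.fib (j + 1) + (-1) ^ j := by
  have h1 : fibFloorSum 1 = 0 := by
    rw [fibFloorSum_succ, fibFloorSum_zero]; simp [floor_fibSlope.1]
  induction j using Nat.twoStepInduction with
  | zero => simp [h1]
  | one =>
    have : fibFloorSum 2 = 0 := by
      rw [fibFloorSum_succ, h1]; norm_num [floor_fibSlope.2]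
    norm_num [Nat.fib_add_two, this]
  | more j h₀ h₁ =>
    have hlt : Nat.fib (j + 2) < Nat.fib (j + 1 + 3) :=
      (Nat.fib_lt_fib_succ (by omega)).trans (Nat.fib_lt_fib_succ (by omega))
    have hadd := fibFloorSum_fib_add (j + 1) (Nat.fib (j + 2)) hlt
    have hc := fib_cassini j
    have e2 : Nat.fib (j + 2) = Nat.fib j + Nat.fib (j + 1) := Nat.fib_add_two
    have e3 : Nat.fib (j + 3) = Nat.fib j + 2 * Nat.fib (j + 1) := by
      rw [Nat.fib_add_two (n := j + 1), e2]; ring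
    have e4 : Nat.fib (j + 4) = Nat.fib (j + 3) + Nat.fib (j + 2) := by
      rw [Nat.fib_add_two (n := j + 2), add_comm]
    have hp : (-1 : ℤ) ^ (j + 2) = (-1) ^ j := by ring
    have hp' : (-1 : ℤ) ^ (j + 1) = -(-1) ^ j := by ring
    rw [show j + 1 + 2 = j + 3 by ring] at hadd h₁
    rw [show j + 1 + 1 = j + 2 by ring, hp'] at h₁
    rw [show j + 2 + 2 = j + 4 by ring, show j + 2 + 1 = j + 3 by ring, hp, e4, hadd]
    rw [mul_add, mul_add, h₀, h₁, e3, e2]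
    push_cast
    linear_combination hc

/-- The numbers `F 2 + F 8 + F 14 + ⋯` and `F 5 + F 11 + F 17 + ⋯`, interlaced; this is
`(F (3s + 2) - 1) / 4`. -/
def fibQuarter : ℕ → ℕ
  | 0 => 0
  | 1 => 1
  | s + 2 => Nat.fib (3 * s + 5) + fibQuarter s

theorem four_mul_fibQuarter (s : ℕ) : 4 * fibQuarter s + 1 = Nat.fib (3 * s + 2) := by
  induction s using Nat.twoStepInduction with
  | zero => simp [fibQuarter]
  | one => simp [fibQuarter, Nat.fib_add_two]
  | more s h₀ _ =>
    rw [fibQuarter, show 3 * (s + 2) + 2 = 3 * s + 8 by ring]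
    simp only [Nat.fib_add_two, Nat.reduceAdd, add_assoc] at h₀ ⊢
    have e := Nat.fib_add_two (n := 3 * s)
    have e1 := Nat.fib_add_two (n := 3 * s + 1)
    have e2 := Nat.fib_add_two (n := 3 * s + 2)
    have e3 := Nat.fib_add_two (n := 3 * s + 3)
    have e4 := Nat.fib_add_two (n := 3 * s + 4)
    have e5 := Nat.fib_add_two (n := 3 * s + 5)
    have e6 := Nat.fib_add_two (n := 3 * s + 6)
    simp only [add_assoc, Nat.reduceAdd] at *
    omega

/-- Each row telescopes to a difference of two floors; summing these over the rows gives differences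
of S. -/
theorem rectangleSum_fibWord (i m : ℕ) :
    rectangleSum fibWord i m m
      = fibFloorSum (i + 2 * m) - 2 * fibFloorSum (i + m) + fibFloorSum i := by
  have hrow : ∀ (a n : ℕ), ∑ l ∈ range n, fibWord (a + l)
      = ⌊((a + n : ℕ) + 1 : ℝ) * fibSlope⌋ - ⌊((a : ℝ) + 1) * fibSlope⌋ := by
    intro a n
    induction n with
    | zero => simp
    | succ n ih =>
      rw [sum_range_succ, ih, fibWord]
      push_cast
      ring_nf
  have hcol : ∀ (a n : ℕ), ∑ k ∈ range n, ⌊((a + k : ℕ) + 1 : ℝ) * fibSlope⌋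
      = fibFloorSum (a + n) - fibFloorSum a := by
    intro a n
    rw [fibFloorSum, fibFloorSum, sum_range_add]
    ring
  have : rectangleSum fibWord i m m
      = ∑ k ∈ range m, ∑ l ∈ range m, fibWord (i + k + l) := by
    simp only [rectangleSum, wordRectangle, Matrix.of_apply]
    rw [← Fin.sum_univ_eq_sum_range (fun k => ∑ l ∈ range m, fibWord (i + k + l))]
    exact sum_congr rfl fun k _ =>
      Fin.sum_univ_eq_sum_range (fun l => fibWord (i + k + l)) m
  rw [this, sum_congr rfl fun k _ => hrow (i + k) m, sum_sub_distrib, hcol i m]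
  have hcomm : ∀ k, i + k + m = i + m + k := fun k => by ring
  simp only [hcomm]
  rw [hcol (i + m) m, show i + m + m = i + 2 * m by ring]
  ring

/-- The third difference of `fibFloorSum` at four points spaced `F (3s + 3) / 2` apart, starting at
`fibQuarter s`, up to sign and after expansion by `fibFloorSum_fib_add`. -/
theorem fibFloorSum_third_difference (s : ℕ) :
    2 * fibFloorSum (Nat.fib (3 * s + 3))
      + (3 * fibQuarter s - fibQuarter (s + 1)) * Nat.fib (3 * s + 1)
      + 4 * fibFloorSum (fibQuarter s) - 4 * fibFloorSum (fibQuarter (s + 1))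
      = (-1) ^ (s + 1) * (s + 1) := by
  induction s with
  | zero =>
    have h := two_mul_fibFloorSum_fib 0
    have h1 := two_mul_fibFloorSum_fib 1
    norm_num [Nat.fib_add_two] at h h1
    norm_num [fibQuarter, fibFloorSum_zero, Nat.fib_add_two, h, h1]
  | succ s ih =>
    have hz0 := four_mul_fibQuarter s
    have hz1 := four_mul_fibQuarter (s + 1)
    have hU3 := two_mul_fibFloorSum_fib (3 * s + 1)
    have hU5 := two_mul_fibFloorSum_fib (3 * s + 3)
    have hU6 := two_mul_fibFloorSum_fib (3 * s + 4)
    have hc := fib_cassini (3 * s)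
    have e2 := Nat.fib_add_two (n := 3 * s)
    have e3 := Nat.fib_add_two (n := 3 * s + 1)
    have e4 := Nat.fib_add_two (n := 3 * s + 2)
    have e5 := Nat.fib_add_two (n := 3 * s + 3)
    have e6 := Nat.fib_add_two (n := 3 * s + 4)
    simp only [add_assoc, Nat.reduceAdd, mul_add, Nat.reduceMul] at *
    have hlt : fibQuarter s < Nat.fib (3 * s + 6) := by omega
    have hW := fibFloorSum_fib_add (3 * s + 3) (fibQuarter s) hlt
    simp only [add_assoc, Nat.reduceAdd] at hW
    have hq : fibQuarter (s + 2) = Nat.fib (3 * s + 5) + fibQuarter s := rfl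
    have p0 : (-1 : ℤ) ^ (3 * s) = (-1) ^ s := by rw [pow_mul]; norm_num
    have p1 : (-1 : ℤ) ^ (3 * s + 1) = -(-1) ^ s := by rw [pow_succ, p0]; ring
    have p3 : (-1 : ℤ) ^ (3 * s + 3) = -(-1) ^ s := by rw [pow_add, p0]; ring
    have p4 : (-1 : ℤ) ^ (3 * s + 4) = (-1) ^ s := by rw [pow_add, p0]; ring
    have q1 : (-1 : ℤ) ^ (s + 1) = -(-1) ^ s := by ring
    have q2 : (-1 : ℤ) ^ (s + 2) = (-1) ^ s := by ring
    rw [p1] at hU3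
    rw [p3] at hU5
    rw [p4] at hU6
    rw [p0] at hc
    rw [q1] at ih
    rw [hq, hW, q2]
    have hYX : 2 * fibQuarter (s + 1) = 2 * fibQuarter s + Nat.fib (3 * s + 3) := by omega
    zify at hYX e2 e3 e4 e5 e6
    push_cast
    simp only [e6, e5, e4, e3, e2] at *
    -- Adding the cases s and s + 1 cancels S(q_s) and S(q_(s+1)), leaving only S at Fibonacci
    -- numbers, which has a closed form.
    linear_combination -ih + hU6 + hU3 - 2 * hU5 - hc
      + (3 * (Nat.fib (3 * s) : ℤ) + 4 * Nat.fib (3 * s + 1)) * hYX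

theorem rectangleSum_fibWord_sub (s : ℕ) :
    rectangleSum fibWord ((Nat.fib (3 * s + 2) - 1) / 4)
        (Nat.fib (3 * s + 3) / 2) (Nat.fib (3 * s + 3) / 2)
      - rectangleSum fibWord ((Nat.fib (3 * s + 5) - 1) / 4)
        (Nat.fib (3 * s + 3) / 2) (Nat.fib (3 * s + 3) / 2) = (-1) ^ (s + 1) * (s + 1) := by
  have hx := four_mul_fibQuarter s
  have hy := four_mul_fibQuarter (s + 1)
  have e3 := Nat.fib_add_two (n := 3 * s + 1)
  have e4 := Nat.fib_add_two (n := 3 * s + 2)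
  have e5 := Nat.fib_add_two (n := 3 * s + 3)
  simp only [add_assoc, Nat.reduceAdd, mul_add, Nat.reduceMul] at *
  rw [show (Nat.fib (3 * s + 2) - 1) / 4 = fibQuarter s by omega,
    show (Nat.fib (3 * s + 5) - 1) / 4 = fibQuarter (s + 1) by omega]
  obtain ⟨m, hm⟩ : ∃ m, m = Nat.fib (3 * s + 3) / 2 := ⟨_, rfl⟩
  have hF : 2 * m = Nat.fib (3 * s + 3) := by omega
  -- The four points are q_s, q_(s+1), F + q_s and F + q_(s+1), where F = F(3s+3).
  rw [← hm, rectangleSum_fibWord, rectangleSum_fibWord, hF,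
    show fibQuarter s + m = fibQuarter (s + 1) by omega,
    show fibQuarter (s + 1) + m = Nat.fib (3 * s + 3) + fibQuarter s by omega,
    add_comm (fibQuarter s), add_comm (fibQuarter (s + 1)),
    fibFloorSum_fib_add (3 * s + 1) (fibQuarter s) (show _ < Nat.fib (3 * s + 4) by omega),
    fibFloorSum_fib_add (3 * s + 1) (fibQuarter (s + 1)) (show _ < Nat.fib (3 * s + 4) by omega)]
  linear_combination fibFloorSum_third_difference s

/-- The change is ⌊a⌋ - 2⌊b⌋ + ⌊c⌋ with a + c = 2b, so fractional parts keep it strictly between -2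
and 2. -/
theorem abs_rectangleSum_fibWord_succ_sub (m i : ℕ) :
    |rectangleSum fibWord (i + 1) m m - rectangleSum fibWord i m m| ≤ 1 := by
  rw [rectangleSum_fibWord, rectangleSum_fibWord, show i + 1 + 2 * m = i + 2 * m + 1 by ring,
    show i + 1 + m = i + m + 1 by ring, fibFloorSum_succ, fibFloorSum_succ, fibFloorSum_succ]
  push_cast
  set a := ((i : ℝ) + 1) * fibSlope with ha
  set b := ((i : ℝ) + m + 1) * fibSlope with hb
  set c := ((i : ℝ) + 2 * m + 1) * fibSlope with hc
  have habc : a + c = 2 * b := by rw [ha, hb, hc]; ring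
  have a1 := Int.floor_le a
  have a2 := Int.lt_floor_add_one a
  have b1 := Int.floor_le b
  have b2 := Int.lt_floor_add_one b
  have c1 := Int.floor_le c
  have c2 := Int.lt_floor_add_one c
  have h1 : ⌊a⌋ + ⌊c⌋ - 2 * ⌊b⌋ < 2 := by
    have : (⌊a⌋ : ℝ) + ⌊c⌋ - 2 * ⌊b⌋ < 2 := by linarith
    exact_mod_cast this
  have h2 : -2 < ⌊a⌋ + ⌊c⌋ - 2 * ⌊b⌋ := by
    have : -2 < (⌊a⌋ : ℝ) + ⌊c⌋ - 2 * ⌊b⌋ := by linarith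
    exact_mod_cast this
  rw [abs_le]
  constructor <;> linarith

/-- A discrete intermediate value theorem. -/
theorem uIcc_subset_range_of_abs_succ_sub_le_one {g : ℕ → ℤ} (hg : ∀ i, |g (i + 1) - g i| ≤ 1)
    (a b : ℕ) : Set.uIcc (g a) (g b) ⊆ Set.range g := by
  wlog hab : a ≤ b generalizing a b
  · rw [Set.uIcc_comm]
    exact this b a (by omega)
  induction b, hab using Nat.le_induction with
  | base => simp
  | succ b _ ih =>
    intro v hv
    by_cases hvb : v ∈ Set.uIcc (g a) (g b)
    · exact ih hvb
    · have h := abs_le.1 (hg b)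
      refine ⟨b + 1, ?_⟩
      simp only [Set.mem_uIcc] at hv hvb
      omega

theorem le_encard_range_rectangleSum (k : ℕ) :
    ((k + 1 : ℕ) : ℕ∞) ≤ (Set.range fun i : ℕ =>
      rectangleSum fibWord i (Nat.fib (3 * k) / 2) (Nat.fib (3 * k) / 2)).encard := by
  rcases k with _ | s
  · simp [Set.one_le_encard_iff_nonempty, Set.range_nonempty]
  · have hd := rectangleSum_fibWord_sub s
    rw [show 3 * (s + 1) = 3 * s + 3 by ring]
    generalize Nat.fib (3 * s + 3) / 2 = m at hd ⊢
    generalize (Nat.fib (3 * s + 2) - 1) / 4 = i at hd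
    generalize (Nat.fib (3 * s + 5) - 1) / 4 = j at hd
    have hsub := Set.encard_le_encard (uIcc_subset_range_of_abs_succ_sub_le_one
      (g := fun i => rectangleSum fibWord i m m) (abs_rectangleSum_fibWord_succ_sub m) j i)
    refine le_trans (le_of_eq ?_) hsub
    rw [← coe_uIcc, Set.encard_coe_eq_coe_finsetCard, Int.card_uIcc, hd, Int.natAbs_mul,
      Int.natAbs_pow]
    simp only [Int.reduceNeg, Int.natAbs_neg, Int.natAbs_one, one_pow, one_mul, Nat.cast_inj]
    omega

theorem theorem8 :
    (∀ k : ℕ,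
      ((k + 1 : ℕ) : ℕ∞) ≤
        (Set.range fun i : ℕ =>
          rectangleSum fibWord i (Nat.fib (3 * k) / 2) (Nat.fib (3 * k) / 2)).encard) ∧
    (∀ n : ℕ, 1 ≤ n →
      rectangleSum fibWord ((Nat.fib (6 * n - 1) - 1) / 4)
          (Nat.fib (6 * n) / 2) (Nat.fib (6 * n) / 2)
        - rectangleSum fibWord ((Nat.fib (6 * n + 2) - 1) / 4)
          (Nat.fib (6 * n) / 2) (Nat.fib (6 * n) / 2) = 2 * (n : ℤ)) ∧
    (∀ n : ℕ,
      rectangleSum fibWord ((Nat.fib (6 * n + 5) - 1) / 4)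
          (Nat.fib (6 * n + 3) / 2) (Nat.fib (6 * n + 3) / 2)
        - rectangleSum fibWord ((Nat.fib (6 * n + 2) - 1) / 4)
          (Nat.fib (6 * n + 3) / 2) (Nat.fib (6 * n + 3) / 2) = 2 * (n : ℤ) + 1) := by
  refine ⟨le_encard_range_rectangleSum, fun n hn => ?_, fun n => ?_⟩
  · obtain ⟨n, rfl⟩ := Nat.exists_eq_add_of_le' hn
    have h := rectangleSum_fibWord_sub (2 * n + 1)
    rw [show 3 * (2 * n + 1) + 2 = 6 * (n + 1) - 1 by omega,
      show 3 * (2 * n + 1) + 3 = 6 * (n + 1) by ring,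
      show 3 * (2 * n + 1) + 5 = 6 * (n + 1) + 2 by ring] at h
    rw [h, show 2 * n + 1 + 1 = 2 * (n + 1) by ring, pow_mul]
    push_cast
    ring
  · have h := rectangleSum_fibWord_sub (2 * n)
    rw [show 3 * (2 * n) = 6 * n by ring, pow_succ, pow_mul] at h
    push_cast at h
    norm_num at h
    linarith
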